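/- Let $K$ be a field of characteristic $0$, let $K\langle x,y\rangle$ be the free unitary associative algebra on $x,y$, and let $\delta$ be its $K$-linear derivation with $\delta(x)=0$, $\delta(y)=x$. Let $K\langle x,y\rangle^{\delta}=\ker\delta$ be the algebra of constants. An element is called bihomogeneous of bidegree $(a,b)$ if it is a linear combination of words with exactly $a$ letters $x$ and $b$ letters $y$, and homogeneous of degree $n$ if it is a linear combination of words of length $n$. (i) $K\langle x,y\rangle^{\delta}$ is a free unitary associative algebra, and it has a system of free generators consisting of bihomogeneous elements. (ii) Let $S$ be any system of free generators of $K\langle x,y\rangle^{\delta}$ consisting of bihomogeneous elements. Then $S$ contains only finitely many elements of each bidegree, every element of $S$ has a bidegree $(a,b)$ with $a\ge b$, and the generating function of $S$, in which a generator of bidegree $(a,b)$ contributes $t^{a}u^{b}=t^{a-b}v^{b}$ with $v=tu$, is \[ a(t,v)=t+\frac{1-\sqrt{1-4v}}{2} \] as a formal power series, where $\sqrt{1-4v}$ is the square root of $1-4v$ with constant term $1$. (iii) Let $SL_2(K)$ act on $K\langle x,y\rangle$ by algebra automorphisms extending its natural linear action on the span of $x,y$. The algebra of invariants $K\langle x,y\rangle^{SL_2(K)}$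 is a free unitary associative algebra with a system of homogeneous free generators. In any system of homogeneous free generators of it, every generator has degree $2n$ for some $n\ge 1$, and for each $n\geq 1$ the number of generators of degree $2n$ is the $n$-th Catalan number $c_n=\frac1n\binom{2n-2}{n-1}$ (so $c_1=c_2=1$, $c_3=2$). -/

import Mathlib

open FreeAlgebra

noncomputable section

namespace FreeConstants

/-- The free unitary associative algebra on two free generators over `K`. -/
abbrev KXY (K : Type*) [Field K] : Type _ := FreeAlgebra K (Fin 2)

/-- The first free generator `x`. -/
def x (K : Type*) [Field K] : KXY K := ι K 0

/-- The second free generator `y`. -/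
def y (K : Type*) [Field K] : KXY K := ι K 1

/-! ### The derivation with `x ↦ 0`, `y ↦ x` -/

/-- The algebra homomorphism `u ↦ u + ε δ(u)` into the dual numbers over the free algebra,
determined by `x ↦ x`, `y ↦ y + ε x`. -/
def dualHom (K : Type*) [Field K] : KXY K →ₐ[K] TrivSqZeroExt (KXY K) (KXY K) :=
  FreeAlgebra.lift K
    ![TrivSqZeroExt.inl (x K), TrivSqZeroExt.inl (y K) + TrivSqZeroExt.inr (x K)]

/-- The derivation `δ` of the free algebra with `δ(x) = 0` and `δ(y) = x`
(see `delta_mul`, `delta_x`, `delta_y`). -/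
def delta (K : Type*) [Field K] : KXY K →ₗ[K] KXY K :=
  (TrivSqZeroExt.sndHom (KXY K) (KXY K)).restrictScalars K ∘ₗ (dualHom K).toLinearMap

theorem fst_dualHom (K : Type*) [Field K] (u : KXY K) : (dualHom K u).fst = u := by
  have h : (TrivSqZeroExt.fstHom K (KXY K) (KXY K)).comp (dualHom K) = AlgHom.id K _ := by
    apply FreeAlgebra.hom_ext
    funext i
    fin_cases i <;> simp [dualHom, x, y]
  exact DFunLike.congr_fun h u

theorem delta_apply (K : Type*) [Field K] (u : KXY K) : delta K u = (dualHom K u).snd := rfl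

theorem delta_x (K : Type*) [Field K] : delta K (x K) = 0 := by
  rw [delta_apply, dualHom]
  conv_lhs => rw [x]
  simp

theorem delta_y (K : Type*) [Field K] : delta K (y K) = x K := by
  rw [delta_apply, dualHom]
  conv_lhs => rw [y]
  simp

theorem delta_mul (K : Type*) [Field K] (u w : KXY K) :
    delta K (u * w) = delta K u * w + u * delta K w := by
  simp only [delta_apply, map_mul, TrivSqZeroExt.snd_mul, fst_dualHom, smul_eq_mul,
    MulOpposite.smul_eq_mul_unop, MulOpposite.unop_op]
  rw [add_comm]

theorem delta_algebraMap (K : Type*) [Field K] (c : K) :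
    delta K (algebraMap K (KXY K) c) = 0 := by
  rw [delta_apply, AlgHom.commutes]
  rfl

/-- The algebra of constants, i.e. the kernel of `δ`. -/
def constants (K : Type*) [Field K] : Subalgebra K (KXY K) where
  carrier := {u | delta K u = 0}
  mul_mem' := by
    intro u w hu hw
    simp only [Set.mem_ofPred_eq] at hu hw ⊢
    rw [delta_mul, hu, hw, zero_mul, mul_zero, add_zero]
  add_mem' := by
    intro u w hu hw
    simp only [Set.mem_ofPred_eq] at hu hw ⊢
    rw [map_add, hu, hw, add_zero]
  algebraMap_mem' := delta_algebraMap K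

/-! ### Invariants of the special linear group -/

/-- The substitution action of a matrix: the algebra endomorphism with `x_j ↦ ∑ i, g i j • x_i`,
where `x_0 = x`, `x_1 = y`. -/
def matrixAct (K : Type*) [Field K] (g : Matrix (Fin 2) (Fin 2) K) : KXY K →ₐ[K] KXY K :=
  FreeAlgebra.lift K (fun j => ∑ i, g i j • ι K i)

/-- The algebra of `SL₂(K)`-invariants. -/
def slInvariants (K : Type*) [Field K] : Subalgebra K (KXY K) :=
  ⨅ g : Matrix.SpecialLinearGroup (Fin 2) K,
    AlgHom.equalizer (matrixAct K (g : Matrix (Fin 2) (Fin 2) K)) (AlgHom.id K (KXY K))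

theorem mem_slInvariants (K : Type*) [Field K] (u : KXY K) :
    u ∈ slInvariants K ↔
      ∀ g : Matrix.SpecialLinearGroup (Fin 2) K,
        matrixAct K (g : Matrix (Fin 2) (Fin 2) K) u = u := by
  simp [slInvariants, Algebra.mem_iInf]

/-! ### Gradings -/

/-- The word in the free generators spelled by a list. -/
def word (K : Type*) [Field K] (l : List (Fin 2)) : KXY K := (l.map (ι K)).prod

/-- The bihomogeneous component of bidegree `(a, b)`: the span of the words with exactly
`a` letters `x` and `b` letters `y`. -/
def bihom (K : Type*) [Field K] (a b : ℕ) : Submodule K (KXY K) :=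
  Submodule.span K {w | ∃ l : List (Fin 2), l.count 0 = a ∧ l.count 1 = b ∧ w = word K l}

/-- The homogeneous component of degree `n`: the span of the words of length `n`. -/
def hom (K : Type*) [Field K] (n : ℕ) : Submodule K (KXY K) :=
  Submodule.span K {w | ∃ l : List (Fin 2), l.length = n ∧ w = word K l}

/-! ### Free generating systems -/

/-- `S` is a system of free generators of the unitary associative algebra `B`: the canonical
homomorphism from the free algebra on the set `S` to `B` is an isomorphism. -/
def IsFreeGenSystem (K : Type*) [Field K] {B : Type*} [Ring B] [Algebra K B] (S : Set B) : Prop :=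
  Function.Bijective (FreeAlgebra.lift K (fun s : S => (s : B)))

/-- Every element of `S` is bihomogeneous. -/
def IsBihomogeneous (K : Type*) [Field K] {B : Subalgebra K (KXY K)} (S : Set B) : Prop :=
  ∀ s ∈ S, ∃ a b : ℕ, (s : KXY K) ∈ bihom K a b

/-- Every element of `S` is homogeneous. -/
def IsHomogeneous (K : Type*) [Field K] {B : Subalgebra K (KXY K)} (S : Set B) : Prop :=
  ∀ s ∈ S, ∃ n : ℕ, (s : KXY K) ∈ hom K n

/-- The elements of `S` of bidegree `(a, b)`. -/
def ofBidegree (K : Type*) [Field K] {B : Subalgebra K (KXY K)} (S : Set B) (a b : ℕ) : Set B :=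
  {s | s ∈ S ∧ (s : KXY K) ∈ bihom K a b}

/-- The elements of `S` of degree `n`. -/
def ofDegree (K : Type*) [Field K] {B : Subalgebra K (KXY K)} (S : Set B) (n : ℕ) : Set B :=
  {s | s ∈ S ∧ (s : KXY K) ∈ hom K n}

/-! ### Generating functions -/

/-- The variable `t`. -/
def t : MvPowerSeries (Fin 2) ℚ := MvPowerSeries.X 0

/-- The variable `v`. -/
def v : MvPowerSeries (Fin 2) ℚ := MvPowerSeries.X 1

/-- The generating function of `S` with respect to `t` and `v = t u`: an element of bidegree
`(a, b)` contributes `t ^ a * u ^ b = t ^ (a - b) * v ^ b`, so the coefficient of `t ^ p * v ^ q`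
is the number of elements of `S` of bidegree `(p + q, q)`. It records all of `S` when all
bidegrees `(a, b)` that occur satisfy `b ≤ a` and each occurs finitely often. -/
def genFun (K : Type*) [Field K] {B : Subalgebra K (KXY K)} (S : Set B) :
    MvPowerSeries (Fin 2) ℚ :=
  fun m => ((ofBidegree K S (m 0 + m 1) (m 1)).ncard : ℚ)

/-- The power series `√(1 - 4 X) = ∑ n, binom(1/2, n) (-4 X) ^ n` in one variable. -/
def sqrtOneSubFourX : PowerSeries ℚ :=
  PowerSeries.rescale (-4 : ℚ) (PowerSeries.binomialSeries ℚ (1 / 2 : ℚ))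

theorem sqrtOneSubFourX_sq : sqrtOneSubFourX ^ 2 = 1 - 4 * PowerSeries.X := by
  have h : PowerSeries.binomialSeries ℚ (1 / 2 : ℚ) ^ 2 = 1 + PowerSeries.X := by
    rw [sq, ← PowerSeries.binomialSeries_add]
    have := PowerSeries.binomialSeries_nat (R := ℚ) (A := ℚ) 1
    norm_num at this ⊢
    exact this
  rw [sqrtOneSubFourX, ← map_pow, h, map_add, map_one, PowerSeries.rescale_X, map_neg, neg_mul,
    ← sub_eq_add_neg, map_ofNat]

theorem constantCoeff_sqrtOneSubFourX : PowerSeries.constantCoeff sqrtOneSubFourX = 1 := by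
  rw [← PowerSeries.coeff_zero_eq_constantCoeff_apply, sqrtOneSubFourX, PowerSeries.coeff_rescale]
  simp

/-- The power series `√(1 - 4 v)` in the variables `t`, `v`. -/
def sqrtOneSubFourV : MvPowerSeries (Fin 2) ℚ := PowerSeries.subst v sqrtOneSubFourX

theorem sqrtOneSubFourV_sq : sqrtOneSubFourV ^ 2 = 1 - 4 * v := by
  have hs : PowerSeries.HasSubst v := PowerSeries.HasSubst.X 1
  rw [sqrtOneSubFourV, ← PowerSeries.subst_pow hs, sqrtOneSubFourX_sq,
    ← PowerSeries.coe_substAlgHom hs]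
  simp only [map_sub, map_one, map_mul, map_ofNat]
  rw [PowerSeries.coe_substAlgHom hs, PowerSeries.subst_X hs]

theorem constantCoeff_sqrtOneSubFourV : MvPowerSeries.constantCoeff sqrtOneSubFourV = 1 := by
  rw [← MvPowerSeries.coeff_zero_eq_constantCoeff_apply, sqrtOneSubFourV, v,
    PowerSeries.coeff_subst_single]
  simp [constantCoeff_sqrtOneSubFourX]

end FreeConstants

end

/-!
Everything rests on the recursion `f ↦ x f y - y f x`, which preserves both the constants of `δ` and
the invariants of `SL₂`. Read a word as a lattice walk, `x` going up and `y` going down. A Dyck word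
factors as `x w₁ y w₂` with Dyck words `w₁`, `w₂`, and replacing each matched pair `x ⋯ y` by a
bracket attaches to it an invariant (`treeElt`) whose lexicographically largest word is the Dyck
word itself. The ballot words, whose walks stay non-negative, form a free monoid on the letter `x`
and the prime Dyck words `x w y` (`genWord_flatten_injective`, `exists_eq_genWord_flatten`). Hence
the products of `x` and of the brackets `x f y - y f x`, with `f` attached to a Dyck word, have
distinct leading words, namely all the ballot words.

These products span. The point is `IsLowering.eq_zero_of_ballot`: an element killed by
`δ ^ (k + 1)` vanishes if its coefficients vanish at all words whose walk from height `k` stays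
non-negative. Indeed, if `u = x a + y b` then `δ ^ (m + 1) u = 0` amounts to `δ ^ (m + 1) b = 0` and
`δ ^ (m + 1) a = -(m + 1) δ ^ m b`; so first `a`, which is killed by `δ ^ (m + 2)`, vanishes by
induction on the degree, and then `b` is killed by `δ ^ m` in characteristic zero. The same argument
applies to `φ - 1` for the unipotent substitution `φ : y ↦ x + y`, so elements fixed by `φ` are also
determined by their coefficients at ballot words; an element fixed by the torus as well only
involves words with equally many `x` and `y`, so `SL₂`-invariants are determined by their
coefficients at Dyck words. By triangularity (`bijective_lift_of_hasLead`) the constants are free on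
`x` and the brackets, and the invariants are free on the brackets alone.

Finally the number of free generators of each degree does not depend on the homogeneous system
(`IsGradedFree.nonempty_equiv`): the linear terms of an element with respect to a system of free
generators give a derivation over the augmentation, so passing from one system to another induces
mutually inverse graded linear maps between the spaces spanned by the two systems. The prime Dyck
words of length `2 n` correspond to the binary trees with `n - 1` nodes, of which there are
`catalan (n - 1)`, and the generating function follows from the quadratic equation of the Catalan
series.
-/

namespace FreeConstants

/-! ### Words as a basis of the free algebra -/

section Words

variable (K : Type*) [Field K]

/-- The word spelled by a list, in the free algebra on an arbitrary set of letters. -/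
noncomputable def mon {X : Type*} (l : List X) : FreeAlgebra K X := (l.map (ι K)).prod

@[simp] theorem mon_nil {X : Type*} : mon K ([] : List X) = 1 := rfl

@[simp] theorem mon_cons {X : Type*} (a : X) (l : List X) : mon K (a :: l) = ι K a * mon K l := by
  simp [mon]

theorem mon_append {X : Type*} (l l' : List X) : mon K (l ++ l') = mon K l * mon K l' := by
  simp [mon]

theorem mon_singleton {X : Type*} (a : X) : mon K [a] = ι K a := by simp

theorem lift_mon {X A : Type*} [Semiring A] [Algebra K A] (f : X → A) (l : List X) :
    FreeAlgebra.lift K f (mon K l) = (l.map f).prod := by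
  induction l with
  | nil => simp
  | cons a l ih => simp [ih]

/-- The words form a basis of the free algebra. -/
noncomputable def monBasis (X : Type*) : Module.Basis (List X) K (FreeAlgebra K X) :=
  (FreeAlgebra.basisFreeMonoid K X).reindex FreeMonoid.toList

@[simp] theorem monBasis_apply {X : Type*} (l : List X) : monBasis K X l = mon K l := by
  have : ∀ m : FreeMonoid X, FreeAlgebra.basisFreeMonoid K X m = FreeMonoid.lift (ι K) m := by
    intro m
    simp [FreeAlgebra.basisFreeMonoid, FreeAlgebra.equivMonoidAlgebraFreeMonoid,
      MonoidAlgebra.coeffLinearEquiv]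
  rw [monBasis, Module.Basis.reindex_apply, this, FreeMonoid.lift_apply]
  rfl

theorem word_eq_mon (l : List (Fin 2)) : word K l = mon K l := rfl

/-- The coefficient of a word. -/
noncomputable def cf {X : Type*} (l : List X) : FreeAlgebra K X →ₗ[K] K := (monBasis K X).coord l

theorem cf_mon {X : Type*} [DecidableEq X] (l l' : List X) :
    cf K l (mon K l') = if l' = l then 1 else 0 := by
  rw [cf, ← monBasis_apply, Module.Basis.coord_apply, Module.Basis.repr_self,
    Finsupp.single_apply]

theorem ext_cf {X : Type*} {u w : FreeAlgebra K X} (h : ∀ l, cf K l u = cf K l w) : u = w :=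
  (monBasis K X).ext_elem h

theorem linearMap_ext_mon {X M : Type*} [AddCommMonoid M] [Module K M]
    {f g : FreeAlgebra K X →ₗ[K] M} (h : ∀ l, f (mon K l) = g (mon K l)) : f = g :=
  (monBasis K X).ext fun l => by simpa using h l

end Words

section LeftLetter

variable {K : Type*} [Field K]

theorem cf_ι_mul_cons {X : Type*} [DecidableEq X] (a b : X) (l : List X) (u : FreeAlgebra K X) :
    cf K (a :: l) (ι K b * u) = if b = a then cf K l u else 0 := by
  have : cf K (a :: l) ∘ₗ LinearMap.mulLeft K (ι K b) = if b = a then cf K l else 0 := by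
    refine linearMap_ext_mon K fun m => ?_
    rw [LinearMap.comp_apply, LinearMap.mulLeft_apply, ← mon_cons, cf_mon]
    by_cases h : b = a <;> simp [h, cf_mon]
  have h2 := LinearMap.congr_fun this u
  rw [LinearMap.comp_apply, LinearMap.mulLeft_apply] at h2
  rw [h2]
  split_ifs <;> rfl

theorem cf_ι_mul_nil {X : Type*} [DecidableEq X] (b : X) (u : FreeAlgebra K X) :
    cf K [] (ι K b * u) = 0 := by
  have : cf K [] ∘ₗ LinearMap.mulLeft K (ι K b) = 0 := by
    refine linearMap_ext_mon K fun m => ?_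
    rw [LinearMap.comp_apply, LinearMap.mulLeft_apply, ← mon_cons, cf_mon]
    simp
  exact LinearMap.congr_fun this u

theorem cf_algebraMap_cons {X : Type*} [DecidableEq X] (a : X) (l : List X) (c : K) :
    cf K (a :: l) (algebraMap K (FreeAlgebra K X) c) = 0 := by
  rw [Algebra.algebraMap_eq_smul_one, ← mon_nil, map_smul, cf_mon]; simp

theorem cf_algebraMap_nil {X : Type*} [DecidableEq X] (c : K) :
    cf K [] (algebraMap K (FreeAlgebra K X) c) = c := by
  rw [Algebra.algebraMap_eq_smul_one, ← mon_nil, map_smul, cf_mon]; simp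

/-- Every element is a scalar plus a left multiple of `x` plus a left multiple of `y`. -/
theorem exists_eq_add_x_mul_add_y_mul (u : KXY K) :
    ∃ (c : K) (a b : KXY K), u = algebraMap K _ c + x K * a + y K * b := by
  have hu : u ∈ Submodule.span K (Set.range (monBasis K (Fin 2))) := by
    rw [Module.Basis.span_eq]; trivial
  induction hu using Submodule.span_induction with
  | mem u h =>
    obtain ⟨l, rfl⟩ := h
    rw [monBasis_apply]
    match l with
    | [] => exact ⟨1, 0, 0, by simp⟩
    | 0 :: l => exact ⟨0, mon K l, 0, by simp [x]⟩
    | 1 :: l => exact ⟨0, 0, mon K l, by simp [y]⟩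
  | zero => exact ⟨0, 0, 0, by simp⟩
  | add u w _ _ hu hw =>
    obtain ⟨c, a, b, rfl⟩ := hu
    obtain ⟨c', a', b', rfl⟩ := hw
    exact ⟨c + c', a + a', b + b', by rw [map_add, mul_add, mul_add]; abel⟩
  | smul r u _ hu =>
    obtain ⟨c, a, b, rfl⟩ := hu
    exact ⟨r * c, r • a, r • b, by simp [Algebra.algebraMap_eq_smul_one, mul_smul]⟩

theorem cf_cons_zero (c : K) (a b : KXY K) (l : List (Fin 2)) :
    cf K (0 :: l) (algebraMap K _ c + x K * a + y K * b) = cf K l a := by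
  rw [map_add, map_add, cf_algebraMap_cons, x, y, cf_ι_mul_cons, cf_ι_mul_cons]; simp

theorem cf_cons_one (c : K) (a b : KXY K) (l : List (Fin 2)) :
    cf K (1 :: l) (algebraMap K _ c + x K * a + y K * b) = cf K l b := by
  rw [map_add, map_add, cf_algebraMap_cons, x, y, cf_ι_mul_cons, cf_ι_mul_cons]; simp

theorem cf_nil_decomp (c : K) (a b : KXY K) :
    cf K [] (algebraMap K _ c + x K * a + y K * b) = c := by
  rw [map_add, map_add, cf_algebraMap_nil, x, y, cf_ι_mul_nil, cf_ι_mul_nil]; simp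

theorem eq_zero_of_x_mul_add_y_mul {a b : KXY K} (h : x K * a + y K * b = 0) : a = 0 ∧ b = 0 := by
  have h' : algebraMap K _ 0 + x K * a + y K * b = 0 := by simpa using h
  constructor <;> refine ext_cf K fun l => ?_
  · rw [← cf_cons_zero 0 a b, h', map_zero, map_zero]
  · rw [← cf_cons_one 0 a b, h', map_zero, map_zero]

end LeftLetter

/-! ### Ballot words -/

/-- The lattice walk that starts at height `k`, goes up at each letter `x` and down at each letter
`y` of the word, never becomes negative. -/
def Ballot : ℕ → List (Fin 2) → Prop
  | _, [] => True
  | k, 0 :: l => Ballot (k + 1) l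
  | 0, 1 :: _ => False
  | k + 1, 1 :: l => Ballot k l

section Detection

variable {K : Type*} [Field K]

/-- A linear operator on `K⟨x, y⟩` which kills the scalars, commutes with left multiplication by
`x`, and satisfies `N (y b) = y N(b) + x φ(b)`, where `φ` commutes with `N` and is the identity on
the kernel of `N`. Both `δ` (with `φ = 1`) and `φ - 1`, where `φ` is
the substitution `x ↦ x`, `y ↦ x + y`, are of this kind. -/
structure IsLowering (N φ : KXY K →ₗ[K] KXY K) : Prop where
  map_scalar : ∀ c, N (algebraMap K _ c) = 0
  map_x_mul : ∀ a, N (x K * a) = x K * N a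
  map_y_mul : ∀ b, N (y K * b) = y K * N b + x K * φ b
  comm : ∀ u, N (φ u) = φ (N u)
  eq_self : ∀ u, N u = 0 → φ u = u

namespace IsLowering

variable {N φ : KXY K →ₗ[K] KXY K}

theorem pow_x_mul (h : IsLowering N φ) (m : ℕ) (a : KXY K) :
    (N ^ m) (x K * a) = x K * (N ^ m) a := by
  induction m with
  | zero => simp
  | succ m ih => rw [pow_succ', Module.End.mul_apply, ih, h.map_x_mul, Module.End.mul_apply]

theorem pow_y_mul (h : IsLowering N φ) (m : ℕ) (b : KXY K) :
    (N ^ (m + 1)) (y K * b) =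
      y K * (N ^ (m + 1)) b + x K * (((m : K) + 1) • φ ((N ^ m) b)) := by
  induction m with
  | zero => simp [h.map_y_mul]
  | succ m ih =>
    rw [pow_succ', Module.End.mul_apply, ih, map_add, h.map_y_mul, h.map_x_mul, map_smul, h.comm,
      ← Module.End.mul_apply N (N ^ m), ← pow_succ', ← Module.End.mul_apply N (N ^ (m + 1)),
      ← pow_succ', add_assoc, ← mul_add]
    congr 2
    push_cast
    module

/-- An element killed by `N ^ (k + 1)` is determined by its coefficients at the words along which
the walk from height `k` stays non-negative. -/
theorem eq_zero_of_ballot [CharZero K] (h : IsLowering N φ) {k : ℕ} {u : KXY K}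
    (hu : (N ^ (k + 1)) u = 0) (hc : ∀ l, Ballot k l → cf K l u = 0) : u = 0 := by
  -- The induction is on a bound for the degree.
  obtain ⟨n, hn⟩ : ∃ n, ∀ l, n ≤ l.length → cf K l u = 0 := by
    refine ⟨(((monBasis K (Fin 2)).repr u).support.sup List.length) + 1, fun l hl => ?_⟩
    by_contra hne
    have : l ∈ ((monBasis K (Fin 2)).repr u).support := by
      simpa [cf] using hne
    have := Finset.le_sup (f := List.length) this
    omega
  induction n generalizing k u with
  | zero => exact ext_cf K fun l => by simpa using hn l (Nat.zero_le _)
  | succ n ih =>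
    obtain ⟨c, a, b, rfl⟩ := exists_eq_add_x_mul_add_y_mul u
    have hc0 : c = 0 := by rw [← cf_nil_decomp c a b, hc [] (by simp [Ballot])]
    subst hc0
    have hna : ∀ l, n ≤ l.length → cf K l a = 0 := fun l hl => by
      rw [← cf_cons_zero 0 a b, hn _ (by simpa using hl)]
    have hnb : ∀ l, n ≤ l.length → cf K l b = 0 := fun l hl => by
      rw [← cf_cons_one 0 a b, hn _ (by simpa using hl)]
    have hca : ∀ l, Ballot (k + 1) l → cf K l a = 0 := fun l hl => by
      rw [← cf_cons_zero 0 a b, hc _ (by simpa [Ballot] using hl)]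
    rw [map_zero, zero_add, map_add, h.pow_x_mul, h.pow_y_mul, add_comm, add_assoc, ← mul_add,
      add_comm] at hu
    obtain ⟨h1, h2⟩ := eq_zero_of_x_mul_add_y_mul hu
    rw [h.eq_self ((N ^ k) b) (by rw [← Module.End.mul_apply, ← pow_succ', h2])] at h1
    have ha : a = 0 := by
      refine ih (k := k + 1) ?_ hca hna
      have := congrArg N h1
      rw [map_add, map_smul, ← Module.End.mul_apply N (N ^ k), ← pow_succ', h2, smul_zero,
        zero_add, map_zero, ← Module.End.mul_apply, ← pow_succ'] at this
      exact this
    have hb : b = 0 := by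
      rw [ha, map_zero, add_zero, smul_eq_zero] at h1
      have h3 := h1.resolve_left (by exact_mod_cast k.succ_ne_zero)
      match k with
      | 0 => simpa using h3
      | k + 1 =>
        refine ih (k := k) h3 (fun l hl => ?_) hnb
        rw [← cf_cons_one 0 a b, hc _ (by simpa [Ballot] using hl)]
    simp [ha, hb]

end IsLowering

theorem isLowering_delta : IsLowering (delta K) LinearMap.id where
  map_scalar := delta_algebraMap K
  map_x_mul a := by rw [delta_mul, delta_x, zero_mul, zero_add]
  map_y_mul b := by rw [delta_mul, delta_y, add_comm]; rfl
  comm _ := rfl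
  eq_self _ _ := rfl

/-- The substitution `x ↦ x`, `y ↦ x + y` minus the identity. -/
theorem isLowering_shear {φ : KXY K →ₐ[K] KXY K} (hx : φ (x K) = x K)
    (hy : φ (y K) = x K + y K) :
    IsLowering (φ.toLinearMap - LinearMap.id) φ.toLinearMap where
  map_scalar c := by simp
  map_x_mul a := by simp [hx, mul_sub]
  map_y_mul b := by simp [hy, mul_sub, add_mul]; abel
  comm u := by simp
  eq_self u hu := by simpa [sub_eq_zero] using hu

end Detection

/-! ### Leading words -/

/-- The number whose binary digits are obtained from a word by reading `x` as `1` and `y` as `0`.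
On words of a fixed length it encodes the lexicographic order with `y < x`. -/
def val : List (Fin 2) → ℕ
  | [] => 0
  | 0 :: l => 2 ^ l.length + val l
  | 1 :: l => val l

theorem val_append (l l' : List (Fin 2)) : val (l ++ l') = val l * 2 ^ l'.length + val l' := by
  induction l with
  | nil => simp [val]
  | cons a l ih =>
    fin_cases a
    · simp [val, ih, pow_add]; ring
    · simp [val, ih]

theorem val_lt (l : List (Fin 2)) : val l < 2 ^ l.length := by
  induction l with
  | nil => simp [val]
  | cons a l ih =>
    fin_cases a <;> simp [val, pow_succ] <;> omega

section Lead

variable (K : Type*) [Field K]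

/-- The span of the words of the same length as `w` which are strictly smaller than `w`. -/
def lowerSpan (w : List (Fin 2)) : Submodule K (KXY K) :=
  Submodule.span K (mon K '' {l | l.length = w.length ∧ val l < val w})

/-- The span of the words of the same length as `w` which are at most `w`. -/
def lowerEqSpan (w : List (Fin 2)) : Submodule K (KXY K) :=
  Submodule.span K (mon K '' {l | l.length = w.length ∧ val l ≤ val w})

/-- The element `f` is homogeneous with leading word `w` and leading coefficient `1`. -/
def HasLead (f : KXY K) (w : List (Fin 2)) : Prop := f - mon K w ∈ lowerSpan K w

variable {K}

theorem lowerSpan_le_lowerEqSpan (w : List (Fin 2)) : lowerSpan K w ≤ lowerEqSpan K w :=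
  Submodule.span_mono (Set.image_mono fun _ h => ⟨h.1, h.2.le⟩)

theorem mon_mem_lowerEqSpan (w : List (Fin 2)) : mon K w ∈ lowerEqSpan K w :=
  Submodule.subset_span ⟨w, ⟨rfl, le_rfl⟩, rfl⟩

theorem lowerSpan_mul_lowerEqSpan {w w' : List (Fin 2)} {p q : KXY K} (hp : p ∈ lowerSpan K w)
    (hq : q ∈ lowerEqSpan K w') : p * q ∈ lowerSpan K (w ++ w') := by
  have h := Submodule.mul_mem_mul hp hq
  rw [lowerSpan, lowerEqSpan, Submodule.span_mul_span] at h
  refine Submodule.span_mono ?_ h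
  rintro _ ⟨_, ⟨l, hl, rfl⟩, _, ⟨l', hl', rfl⟩, rfl⟩
  refine ⟨l ++ l', ⟨by simp [hl.1, hl'.1], ?_⟩, mon_append K _ _⟩
  rw [val_append, val_append, hl'.1]
  have := Nat.mul_lt_mul_of_pos_right hl.2 (Nat.two_pow_pos w'.length)
  have := hl'.2
  omega

theorem lowerEqSpan_mul_lowerSpan {w w' : List (Fin 2)} {p q : KXY K} (hp : p ∈ lowerEqSpan K w)
    (hq : q ∈ lowerSpan K w') : p * q ∈ lowerSpan K (w ++ w') := by
  have h := Submodule.mul_mem_mul hp hq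
  rw [lowerSpan, lowerEqSpan, Submodule.span_mul_span] at h
  refine Submodule.span_mono ?_ h
  rintro _ ⟨_, ⟨l, hl, rfl⟩, _, ⟨l', hl', rfl⟩, rfl⟩
  refine ⟨l ++ l', ⟨by simp [hl.1, hl'.1], ?_⟩, mon_append K _ _⟩
  rw [val_append, val_append, hl'.1]
  have := Nat.mul_le_mul_right (2 ^ w'.length) hl.2
  have := hl'.2
  omega

theorem HasLead.mem_lowerEqSpan {f : KXY K} {w : List (Fin 2)} (h : HasLead K f w) :
    f ∈ lowerEqSpan K w := by
  rw [← sub_add_cancel f (mon K w)]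
  exact add_mem (lowerSpan_le_lowerEqSpan w h) (mon_mem_lowerEqSpan w)

theorem hasLead_mon (w : List (Fin 2)) : HasLead K (mon K w) w := by
  rw [HasLead, sub_self]; exact zero_mem _

theorem HasLead.mul {f g : KXY K} {w w' : List (Fin 2)} (hf : HasLead K f w)
    (hg : HasLead K g w') : HasLead K (f * g) (w ++ w') := by
  have : f * g - mon K (w ++ w') = (f - mon K w) * g + mon K w * (g - mon K w') := by
    rw [mon_append]; noncomm_ring
  rw [HasLead, this]
  exact add_mem (lowerSpan_mul_lowerEqSpan hf hg.mem_lowerEqSpan)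
    (lowerEqSpan_mul_lowerSpan (mon_mem_lowerEqSpan w) hg)

theorem HasLead.list_prod {P : Type*} {gen : P → KXY K} {gw : P → List (Fin 2)}
    (h : ∀ p, HasLead K (gen p) (gw p)) (i : List P) :
    HasLead K (i.map gen).prod (i.map gw).flatten := by
  induction i with
  | nil => exact hasLead_mon []
  | cons p i ih => simpa using (h p).mul ih

/-- The bracket `x f y - y f x` has leading word `x w y` when `f` has leading word `w`. -/
theorem HasLead.bracket {f : KXY K} {w : List (Fin 2)} (h : HasLead K f w) :
    HasLead K (x K * f * y K - y K * f * x K) (0 :: w ++ [1]) := by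
  have h1 : HasLead K (x K * f * y K) (0 :: w ++ [1]) := by
    have := ((hasLead_mon (K := K) [0]).mul h).mul (hasLead_mon [1])
    simpa [x, y] using this
  have h2 : y K * f * x K ∈ lowerSpan K (0 :: w ++ [1]) := by
    have hf := h.mem_lowerEqSpan
    clear h h1
    rw [lowerEqSpan] at hf
    induction hf using Submodule.span_induction with
    | mem u hu =>
      obtain ⟨l, hl, rfl⟩ := hu
      refine Submodule.subset_span ⟨1 :: l ++ [0], ⟨by simp [hl.1], ?_⟩, ?_⟩
      · have h1 := val_lt l
        rw [hl.1] at h1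
        simp only [val, List.cons_append, val_append]
        simp [pow_succ]
        omega
      · rw [List.cons_append, mon_cons, mon_append, mon_singleton, x, y, mul_assoc]
    | zero => simp
    | add u v _ _ hu hv => rw [mul_add, add_mul]; exact add_mem hu hv
    | smul c u _ hu => rw [mul_smul_comm, smul_mul_assoc]; exact Submodule.smul_mem _ _ hu
  rw [HasLead] at h1 ⊢
  rw [sub_right_comm]
  exact sub_mem h1 h2

theorem cf_eq_zero_of_mem_lowerSpan {w l : List (Fin 2)} {u : KXY K} (hu : u ∈ lowerSpan K w)
    (hl : val w ≤ val l) : cf K l u = 0 := by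
  rw [lowerSpan] at hu
  induction hu using Submodule.span_induction with
  | mem u hu =>
    obtain ⟨m, hm, rfl⟩ := hu
    rw [cf_mon, if_neg]
    rintro rfl
    exact absurd hm.2 (not_lt.2 hl)
  | zero => simp
  | add u v _ _ hu hv => rw [map_add, hu, hv, add_zero]
  | smul c u _ hu => rw [map_smul, hu, smul_zero]

theorem linearIndependent_of_hasLead {I : Type*} {ω : I → List (Fin 2)}
    (hω : Function.Injective ω) {f : I → KXY K} (hf : ∀ i, HasLead K (f i) (ω i)) :
    LinearIndependent K f := by
  rw [linearIndependent_iff]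
  intro c hc
  by_contra hne
  obtain ⟨i, hi, hmax⟩ := c.support.exists_max_image (fun i => val (ω i))
    (Finsupp.support_nonempty_iff.2 hne)
  refine Finsupp.mem_support_iff.1 hi ?_
  have h := congrArg (cf K (ω i)) hc
  rw [map_zero, Finsupp.linearCombination_apply, Finsupp.sum, map_sum, Finset.sum_eq_single i] at h
  · rw [map_smul, ← sub_add_cancel (f i) (mon K (ω i)), map_add,
      cf_eq_zero_of_mem_lowerSpan (hf i) le_rfl, cf_mon] at h
    simpa using h
  · intro j hj hji
    rw [map_smul, ← sub_add_cancel (f j) (mon K (ω j)), map_add,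
      cf_eq_zero_of_mem_lowerSpan (hf j) (hmax j hj), cf_mon, if_neg (hω.ne hji)]
    simp
  · exact fun h => absurd hi h

/-- If the elements of `B` are determined by their coefficients at the leading words of the
family `f`, then `f` spans `B`: by triangularity a linear combination of the family can be chosen
with any prescribed coefficients at these words. -/
theorem le_span_of_hasLead {I : Type*} {ω : I → List (Fin 2)}
    (hω : Function.Injective ω) {f : I → KXY K} (hf : ∀ i, HasLead K (f i) (ω i))
    {B : Submodule K (KXY K)} (hfB : ∀ i, f i ∈ B)
    (hB : ∀ u ∈ B, (∀ i, cf K (ω i) u = 0) → u = 0) : B ≤ Submodule.span K (Set.range f) := by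
  let R : KXY K →ₗ[K] (I →₀ K) :=
    Finsupp.lcomapDomain ω hω ∘ₗ (monBasis K (Fin 2)).repr.toLinearMap
  have hR : ∀ u i, R u i = cf K (ω i) u := fun _ _ => rfl
  have key : ∀ (n : ℕ) (i : I), val (ω i) = n →
      Finsupp.single i 1 ∈ (Submodule.span K (Set.range f)).map R := by
    intro n
    induction n using Nat.strong_induction_on with
    | _ n ih =>
      intro i hi
      have h1 : R (f i) ∈ (Submodule.span K (Set.range f)).map R :=
        Submodule.mem_map_of_mem (Submodule.subset_span ⟨i, rfl⟩)
      have h2 : lowerSpan K (ω i) ≤ ((Submodule.span K (Set.range f)).map R).comap R := by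
        rw [lowerSpan, Submodule.span_le]
        rintro _ ⟨l, hl, rfl⟩
        rw [SetLike.mem_coe, Submodule.mem_comap]
        by_cases hlj : ∃ j, ω j = l
        · obtain ⟨j, rfl⟩ := hlj
          have : R (mon K (ω j)) = Finsupp.single j 1 := by
            ext k
            classical
            rw [hR, cf_mon, Finsupp.single_apply]
            simp [hω.eq_iff]
          rw [this]
          exact ih _ (hi ▸ hl.2) j rfl
        · have : R (mon K l) = 0 := by
            ext k
            rw [hR, cf_mon, if_neg fun h => hlj ⟨k, h.symm⟩]; rfl
          rw [this]; exact zero_mem _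
      have h3 : Finsupp.single i 1 = R (f i) - R (f i - mon K (ω i)) := by
        rw [← map_sub, sub_sub_cancel]
        ext k
        classical
        rw [hR, cf_mon, Finsupp.single_apply]
        simp [hω.eq_iff]
      rw [h3]
      exact sub_mem h1 (h2 (hf i))
  intro u hu
  have htop : (Submodule.span K (Set.range f)).map R = ⊤ := by
    rw [eq_top_iff, ← Finsupp.basisSingleOne.span_eq, Submodule.span_le]
    rintro _ ⟨i, rfl⟩
    simpa using key _ i rfl
  obtain ⟨z, hz, hzu⟩ : R u ∈ (Submodule.span K (Set.range f)).map R := by rw [htop]; trivial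
  have hzB : z ∈ B := (Submodule.span_le.2 (by rintro _ ⟨i, rfl⟩; exact hfB i)) hz
  have : u - z = 0 := by
    refine hB _ (sub_mem hu hzB) fun i => ?_
    rw [← hR, map_sub, hzu, sub_self]; rfl
  rwa [sub_eq_zero.1 this]

/-- A family of elements of `B` whose leading words freely generate a monoid, and are such that
elements of `B` are determined by their coefficients at the words of that monoid, generates `B`
freely. -/
theorem bijective_lift_of_hasLead {P : Type*} {B : Subalgebra K (KXY K)} (gen : P → B)
    (gw : P → List (Fin 2)) (hlead : ∀ p, HasLead K (gen p : KXY K) (gw p))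
    (hinj : Function.Injective fun i : List P => (i.map gw).flatten)
    (hB : ∀ u ∈ B, (∀ i : List P, cf K (i.map gw).flatten u = 0) → u = 0) :
    Function.Bijective (FreeAlgebra.lift K gen) := by
  let f : List P → KXY K := fun i => (i.map fun p => (gen p : KXY K)).prod
  have hf : ∀ i, HasLead K (f i) (i.map gw).flatten := HasLead.list_prod hlead
  have hlift : ∀ i, (FreeAlgebra.lift K gen (mon K i) : KXY K) = f i := by
    intro i
    rw [lift_mon]
    induction i with
    | nil => rfl
    | cons p i ih =>
      rw [List.map_cons, List.prod_cons, MulMemClass.coe_mul, ih]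
      simp [f]
  constructor
  · let F : FreeAlgebra K P →ₗ[K] KXY K := B.val.toLinearMap ∘ₗ (FreeAlgebra.lift K gen).toLinearMap
    have hF : Function.Injective F := by
      have h : F = Finsupp.linearCombination K f ∘ₗ (monBasis K P).repr.toLinearMap := by
        refine linearMap_ext_mon K fun i => ?_
        have h1 : Finsupp.linearCombination K f ((monBasis K P).repr (mon K i)) = f i := by
          rw [← monBasis_apply, Module.Basis.repr_self, Finsupp.linearCombination_single, one_smul]
        exact (hlift i).trans h1.symm
      rw [h, LinearMap.coe_comp]
      exact Function.Injective.comp (linearIndependent_of_hasLead hinj hf)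
        (monBasis K P).repr.injective
    exact fun a b hab => hF (congrArg Subtype.val hab)
  · intro u
    have hu := le_span_of_hasLead hinj hf (B := Subalgebra.toSubmodule B)
      (fun i => by rw [← hlift]; exact Subtype.property _) hB u.2
    have : Submodule.span K (Set.range f) ≤ LinearMap.range
        (B.val.toLinearMap ∘ₗ (FreeAlgebra.lift K gen).toLinearMap) := by
      rw [Submodule.span_le]
      rintro _ ⟨i, rfl⟩
      exact ⟨mon K i, hlift i⟩
    obtain ⟨z, hz⟩ := this hu
    exact ⟨z, Subtype.ext hz⟩

theorem isFreeGenSystem_range {P B : Type*} [Ring B] [Algebra K B] {gen : P → B}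
    (h : Function.Bijective (FreeAlgebra.lift K gen)) :
    IsFreeGenSystem K (Set.range gen) ∧ Function.Injective gen := by
  have hinj : Function.Injective gen := fun p q hpq => by
    refine FreeAlgebra.ι_injective (R := K) (h.1 ?_)
    simpa using hpq
  refine ⟨?_, hinj⟩
  let e : Set.range gen ≃ P := (Equiv.ofInjective gen hinj).symm
  let E : FreeAlgebra K (Set.range gen) ≃ₐ[K] FreeAlgebra K P :=
    AlgEquiv.ofAlgHom (FreeAlgebra.lift K fun s => ι K (e s))
      (FreeAlgebra.lift K fun p => ι K (e.symm p)) (by ext; simp) (by ext; simp)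
  have : FreeAlgebra.lift K (fun s : Set.range gen => (s : B)) =
      (FreeAlgebra.lift K gen).comp E.toAlgHom := by
    ext s
    obtain ⟨p, rfl⟩ := e.symm.surjective s
    simp [E, e]
  rw [IsFreeGenSystem, this]
  exact h.comp E.bijective

end Lead

/-! ### Factorization of ballot words -/

open BinaryTree

/-- The Dyck word of a binary tree: the empty tree gives the empty word, and the tree with subtrees
`a`, `b` gives `x w(a) y w(b)`. -/
def treeWord : BinaryTree Unit → List (Fin 2)
  | nil => []
  | node _ a b => 0 :: treeWord a ++ 1 :: treeWord b

/-- The free generators of the monoid of ballot words: the letter `x` (`none`) and the prime Dyck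
words `x w(a) y`. -/
def genWord : Option (BinaryTree Unit) → List (Fin 2)
  | none => [0]
  | some a => 0 :: treeWord a ++ [1]

theorem ballot_treeWord_append (a : BinaryTree Unit) (k : ℕ) (r : List (Fin 2)) :
    Ballot k (treeWord a ++ r) ↔ Ballot k r := by
  induction a generalizing k r with
  | nil => rfl
  | node _ a b iha ihb =>
    rw [treeWord, List.cons_append, List.cons_append, Ballot, List.append_assoc, iha,
      List.cons_append, Ballot, ihb]

theorem ballot_genWord_flatten (i : List (Option (BinaryTree Unit))) (k : ℕ) :
    Ballot k (i.map genWord).flatten := by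
  induction i generalizing k with
  | nil => simp [Ballot]
  | cons p i ih =>
    cases p with
    | none => simpa [genWord, Ballot] using ih (k + 1)
    | some a => simpa [genWord, Ballot, ballot_treeWord_append] using ih k

theorem treeWord_append_cons_inj {a a' : BinaryTree Unit} {r r' : List (Fin 2)}
    (h : treeWord a ++ 1 :: r = treeWord a' ++ 1 :: r') : a = a' ∧ r = r' := by
  induction a generalizing a' r r' with
  | nil =>
    cases a' with
    | nil => simpa [treeWord] using h
    | node _ a' b' => simp [treeWord] at h
  | node _ a b iha ihb =>
    cases a' with
    | nil => simp [treeWord] at h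
    | node _ a' b' =>
      simp only [treeWord, List.cons_append, List.append_assoc, List.cons.injEq, true_and] at h
      obtain ⟨rfl, h'⟩ := iha h
      obtain ⟨rfl, rfl⟩ := ihb h'
      exact ⟨rfl, rfl⟩

theorem genWord_flatten_injective :
    Function.Injective fun i : List (Option (BinaryTree Unit)) => (i.map genWord).flatten := by
  -- If one word begins with the letter `x` as a generator and the other with a prime Dyck word,
  -- then cancelling the first `x` gives a ballot word on the left of `hne`, whereas on the right
  -- the letter `y` after the Dyck word leads below height zero.
  have hne : ∀ (a : BinaryTree Unit) (i j : List (Option (BinaryTree Unit))),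
      (i.map genWord).flatten ≠ treeWord a ++ 1 :: (j.map genWord).flatten := by
    intro a i j h
    have h1 := ballot_genWord_flatten i 0
    rw [h, ballot_treeWord_append] at h1
    exact h1
  intro i
  induction i with
  | nil =>
    intro j h
    match j with
    | [] => rfl
    | none :: j => simp [genWord] at h
    | some a :: j => simp [genWord] at h
  | cons p i ih =>
    intro j h
    match p, j with
    | none, [] => simp [genWord] at h
    | some a, [] => simp [genWord] at h
    | none, none :: j => rw [ih (by simpa [genWord] using h)]
    | none, some a :: j => exact absurd (by simpa [genWord] using h) (hne a i j)
    | some a, none :: j => exact absurd (by simpa [genWord] using h.symm) (hne a j i)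
    | some a, some b :: j =>
      obtain ⟨rfl, h'⟩ := treeWord_append_cons_inj (a := a) (a' := b)
        (r := (i.map genWord).flatten) (r' := (j.map genWord).flatten)
        (by simpa [genWord] using h)
      rw [ih h']

/-- A walk which starts at height `k` and stays non-negative either never goes below `k`, and is then
a product of letters `x` and prime Dyck words, or it does so for the first time at the letter `y`
after a Dyck word. The bound `n` on the length serves the induction. -/
theorem exists_factorization_of_ballot (n : ℕ) : ∀ (l : List (Fin 2)) (k : ℕ), l.length ≤ n →
    Ballot k l → (∃ i : List (Option (BinaryTree Unit)), l = (i.map genWord).flatten) ∨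
      ∃ k' a l', k = k' + 1 ∧ l = treeWord a ++ 1 :: l' ∧ Ballot k' l' := by
  induction n with
  | zero =>
    intro l k hl _
    exact Or.inl ⟨[], by simpa using hl⟩
  | succ n ih =>
    intro l k hl hb
    match l, k with
    | [], _ => exact Or.inl ⟨[], rfl⟩
    | 1 :: l, 0 => exact hb.elim
    | 1 :: l, k + 1 => exact Or.inr ⟨k, nil, l, rfl, rfl, hb⟩
    | 0 :: l, k =>
      simp only [List.length_cons] at hl
      rcases ih l (k + 1) (by omega) hb with ⟨i, rfl⟩ | ⟨k', a, l', hk, rfl, hb'⟩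
      · exact Or.inl ⟨none :: i, by simp [genWord]⟩
      · obtain rfl : k = k' := by omega
        simp only [List.length_append, List.length_cons] at hl
        rcases ih l' k (by omega) hb' with ⟨i, rfl⟩ | ⟨k'', b, l'', hk, rfl, hb''⟩
        · exact Or.inl ⟨some a :: i, by simp [genWord]⟩
        · exact Or.inr ⟨k'', node () a b, l'', hk, by simp [treeWord], hb''⟩

/-- Every ballot word is a product of letters `x` and prime Dyck words. -/
theorem exists_eq_genWord_flatten {l : List (Fin 2)} (h : Ballot 0 l) :
    ∃ i : List (Option (BinaryTree Unit)), l = (i.map genWord).flatten := by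
  rcases exists_factorization_of_ballot _ l 0 le_rfl h with h | ⟨k', _, _, hk, _⟩
  · exact h
  · omega

theorem count_treeWord (c : Fin 2) (a : BinaryTree Unit) :
    (treeWord a).count c = a.numNodes := by
  induction a with
  | nil => rfl
  | node _ a b iha ihb =>
    fin_cases c <;> simp [treeWord, numNodes] at * <;> omega

theorem count_genWord_some (c : Fin 2) (a : BinaryTree Unit) :
    (genWord (some a)).count c = a.numNodes + 1 := by
  fin_cases c <;> simp [genWord, count_treeWord]

/-- The ballot words with as many letters `x` as letters `y` are the products of prime Dyck
words. -/
theorem exists_eq_map_some_of_count_eq {i : List (Option (BinaryTree Unit))}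
    (h : (i.map genWord).flatten.count 0 = (i.map genWord).flatten.count 1) :
    ∃ j : List (BinaryTree Unit), i = j.map some := by
  have hle : ∀ i : List (Option (BinaryTree Unit)),
      (i.map genWord).flatten.count 1 ≤ (i.map genWord).flatten.count 0 := by
    intro i
    induction i with
    | nil => simp
    | cons p i ih =>
      cases p with
      | none => simp [genWord] at *; omega
      | some a =>
        simp only [List.map_cons, List.flatten_cons, List.count_append, count_genWord_some]
        omega
  induction i with
  | nil => exact ⟨[], rfl⟩
  | cons p i ih =>
    cases p with
    | none =>
      have := hle i
      simp [genWord] at *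
      omega
    | some a =>
      simp only [List.map_cons, List.flatten_cons, List.count_append, count_genWord_some] at h
      obtain ⟨j, rfl⟩ := ih (by omega)
      exact ⟨a :: j, rfl⟩

/-! ### Weight gradings of a free algebra -/

section Grading

variable (K : Type*) [Field K] {X M : Type*} [AddCommMonoid M]

/-- The homogeneous component of degree `d` of the free algebra on `X`, for the grading in which the
letter `a` has degree `wt a`. -/
noncomputable def comp (wt : X → M) (d : M) : Submodule K (FreeAlgebra K X) :=
  Submodule.span K (mon K '' {l | (l.map wt).sum = d})

variable {K}

theorem mon_mem_comp (wt : X → M) (l : List X) : mon K l ∈ comp K wt (l.map wt).sum :=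
  Submodule.subset_span ⟨l, rfl, rfl⟩

theorem ι_mem_comp (wt : X → M) (a : X) : ι K a ∈ comp K wt (wt a) := by
  simpa using mon_mem_comp (K := K) wt [a]

theorem one_mem_comp (wt : X → M) : (1 : FreeAlgebra K X) ∈ comp K wt 0 := by
  simpa using mon_mem_comp (K := K) wt []

theorem mul_mem_comp {wt : X → M} {d e : M} {u w : FreeAlgebra K X} (hu : u ∈ comp K wt d)
    (hw : w ∈ comp K wt e) : u * w ∈ comp K wt (d + e) := by
  have h := Submodule.mul_mem_mul hu hw
  rw [comp, comp, Submodule.span_mul_span] at h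
  refine Submodule.span_mono ?_ h
  rintro _ ⟨_, ⟨l, hl, rfl⟩, _, ⟨l', hl', rfl⟩, rfl⟩
  refine ⟨l ++ l', ?_, mon_append K _ _⟩
  simp_all

theorem mem_comp_iff {wt : X → M} {d : M} {u : FreeAlgebra K X} :
    u ∈ comp K wt d ↔ ∀ l, cf K l u ≠ 0 → (l.map wt).sum = d := by
  have : mon K (X := X) = monBasis K X := by ext; simp
  rw [comp, this, Module.Basis.mem_span_image]
  constructor
  · intro h l hl
    exact h (by simpa [cf] using hl)
  · intro h l hl
    exact h l (by simpa [cf] using hl)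

theorem eq_of_mem_comp {wt : X → M} {d e : M} {u : FreeAlgebra K X} (hu : u ≠ 0)
    (hd : u ∈ comp K wt d) (he : u ∈ comp K wt e) : d = e := by
  obtain ⟨l, hl⟩ : ∃ l, cf K l u ≠ 0 := by
    by_contra! h
    exact hu (ext_cf K fun l => by rw [h l, map_zero])
  rw [← mem_comp_iff.1 hd l hl, mem_comp_iff.1 he l hl]

open Classical in
/-- The projection to the homogeneous component of degree `d`. -/
noncomputable def compProj (wt : X → M) (d : M) : FreeAlgebra K X →ₗ[K] FreeAlgebra K X :=
  (monBasis K X).constr K fun l => if (l.map wt).sum = d then mon K l else 0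

open Classical in
theorem compProj_mon (wt : X → M) (d : M) (l : List X) :
    compProj wt d (mon K l) = if (l.map wt).sum = d then mon K l else 0 := by
  have h := (monBasis K X).constr_basis K
    (fun l => if (l.map wt).sum = d then mon K l else 0) l
  rwa [monBasis_apply] at h

theorem compProj_of_mem {wt : X → M} {d : M} {u : FreeAlgebra K X} (hu : u ∈ comp K wt d) :
    compProj wt d u = u := by
  rw [comp] at hu
  induction hu using Submodule.span_induction with
  | mem u hu =>
    obtain ⟨l, hl, rfl⟩ := hu
    rw [compProj_mon]
    exact if_pos hl
  | zero => simp
  | add u w _ _ hu hw => rw [map_add, hu, hw]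
  | smul c u _ hu => rw [map_smul, hu]

theorem compProj_of_mem_of_ne {wt : X → M} {d e : M} {u : FreeAlgebra K X}
    (hu : u ∈ comp K wt e) (h : e ≠ d) : compProj wt d u = 0 := by
  rw [comp] at hu
  induction hu using Submodule.span_induction with
  | mem u hu =>
    obtain ⟨l, hl, rfl⟩ := hu
    rw [compProj_mon]
    exact if_neg (hl.trans_ne h)
  | zero => simp
  | add u w _ _ hu hw => rw [map_add, hu, hw, add_zero]
  | smul c u _ hu => rw [map_smul, hu, smul_zero]

theorem cf_compProj_of_ne {wt : X → M} {d : M} {l : List X} (h : (l.map wt).sum ≠ d)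
    (u : FreeAlgebra K X) : cf K l (compProj wt d u) = 0 := by
  have : cf K l ∘ₗ compProj wt d = 0 := by
    refine linearMap_ext_mon K fun m => ?_
    classical
    rw [LinearMap.comp_apply, compProj_mon]
    split_ifs with hm
    · rw [cf_mon, if_neg]
      · rfl
      · rintro rfl; exact h hm
    · simp
  exact LinearMap.congr_fun this u

end Grading

/-! ### Homogeneous systems of free generators have the same degrees -/

section Comparison

variable {K : Type*} [Field K] {M : Type*} [AddCommMonoid M] {wt : Fin 2 → M}
  {B : Subalgebra K (KXY K)} {P Q : Type*}

/-- A family of homogeneous free generators of a subalgebra of `K⟨x, y⟩`, with their degrees. -/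
structure IsGradedFree (wt : Fin 2 → M) (gen : P → B) (deg : P → M) : Prop where
  bijective : Function.Bijective (FreeAlgebra.lift K gen)
  mem_comp : ∀ p, (gen p : KXY K) ∈ comp K wt (deg p)

/-- The augmentation of `K⟨x, y⟩`, which kills `x` and `y`. -/
noncomputable def augmentation (K : Type*) [Field K] : KXY K →ₐ[K] K :=
  FreeAlgebra.lift K fun _ => 0

/-- The homomorphism from the free algebra on `P` to the square-zero extension of `K` by the vector
space on `P` that records the constant and the linear terms of an element. -/
noncomputable def linearTerms (K P : Type*) [Field K] :
    FreeAlgebra K P →ₐ[K] TrivSqZeroExt K (P →₀ K) :=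
  FreeAlgebra.lift K fun p => TrivSqZeroExt.inr (Finsupp.single p 1)

theorem snd_linearTerms (p : P) (z : FreeAlgebra K P) :
    (linearTerms K P z).snd p = cf K [p] z := by
  classical
  have : Finsupp.lapply p ∘ₗ (TrivSqZeroExt.sndHom K (P →₀ K)) ∘ₗ
      (linearTerms K P).toLinearMap = cf K [p] := by
    refine linearMap_ext_mon K fun l => ?_
    rw [cf_mon, LinearMap.comp_apply, LinearMap.comp_apply, AlgHom.toLinearMap_apply, linearTerms,
      lift_mon]
    match l with
    | [] => simp
    | [q] => simp [Finsupp.single_apply]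
    | q :: r :: l => simp [← mul_assoc]
  exact LinearMap.congr_fun this z

namespace IsGradedFree

variable {gen : P → B} {deg : P → M} {gen' : Q → B} {deg' : Q → M}

theorem ne_algebraMap (h : IsGradedFree wt gen deg) (p : P) (c : K) :
    (gen p : KXY K) ≠ algebraMap K _ c := by
  intro hp
  refine FreeAlgebra.ι_ne_algebraMap p c (h.bijective.1 (Subtype.ext ?_))
  rw [FreeAlgebra.lift_ι_apply, hp, AlgHom.commutes]
  rfl

theorem ne_zero (h : IsGradedFree wt gen deg) (p : P) : (gen p : KXY K) ≠ 0 := by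
  simpa using h.ne_algebraMap p 0

theorem mem_comp_iff (h : IsGradedFree wt gen deg) (p : P) (d : M) :
    (gen p : KXY K) ∈ comp K wt d ↔ deg p = d :=
  ⟨fun hd => eq_of_mem_comp (h.ne_zero p) (h.mem_comp p) hd, fun hd => hd ▸ h.mem_comp p⟩

/-- Free generators have zero constant term: a free generator of degree zero would be a scalar. -/
theorem augmentation_gen (h : IsGradedFree wt gen deg)
    (hwt : ∀ l : List (Fin 2), (l.map wt).sum = 0 → l = []) (p : P) :
    augmentation K (gen p) = 0 := by
  have hne : deg p ≠ 0 := by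
    intro h0
    have hp := h.mem_comp p
    have h1 : {l : List (Fin 2) | (l.map wt).sum = 0} = {[]} := by
      ext l
      exact ⟨hwt l, fun h => by rw [Set.mem_singleton_iff.1 h]; rfl⟩
    rw [h0, comp, h1, Set.image_singleton, mon_nil, Submodule.mem_span_singleton] at hp
    obtain ⟨c, hc⟩ := hp
    exact h.ne_algebraMap p c (by rw [← hc, Algebra.algebraMap_eq_smul_one])
  have hp := h.mem_comp p
  rw [comp] at hp
  have : Submodule.span K (mon K '' {l | (l.map wt).sum = deg p}) ≤
      LinearMap.ker (augmentation K).toLinearMap := by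
    rw [Submodule.span_le]
    rintro _ ⟨l, hl, rfl⟩
    match l with
    | [] => exact absurd (show (0 : M) = deg p from hl).symm hne
    | a :: l => simp [augmentation]
  exact this hp

/-- The algebra isomorphism of the free algebra on the generators with `B`. -/
noncomputable def equiv (h : IsGradedFree wt gen deg) : FreeAlgebra K P ≃ₐ[K] B :=
  AlgEquiv.ofBijective (FreeAlgebra.lift K gen) h.bijective

theorem equiv_ι (h : IsGradedFree wt gen deg) (p : P) : h.equiv (ι K p) = gen p := by
  simp [equiv]

theorem equiv_symm_gen (h : IsGradedFree wt gen deg) (p : P) : h.equiv.symm (gen p) = ι K p := by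
  rw [← h.equiv_ι, AlgEquiv.symm_apply_apply]

theorem equiv_mon_mem_comp (h : IsGradedFree wt gen deg) (l : List P) :
    (h.equiv (mon K l) : KXY K) ∈ comp K wt (l.map deg).sum := by
  induction l with
  | nil => simpa using one_mem_comp wt
  | cons p l ih =>
    rw [mon_cons, map_mul, h.equiv_ι, List.map_cons, List.sum_cons]
    exact mul_mem_comp (h.mem_comp p) ih

/-- Constant and linear terms of an element of `B` with respect to a system of free generators. -/
noncomputable def terms (h : IsGradedFree wt gen deg) : B →ₐ[K] TrivSqZeroExt K (P →₀ K) :=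
  (linearTerms K P).comp h.equiv.symm.toAlgHom

theorem terms_gen (h : IsGradedFree wt gen deg) (p : P) :
    h.terms (gen p) = TrivSqZeroExt.inr (Finsupp.single p 1) := by
  have : h.terms (gen p) = linearTerms K P (h.equiv.symm (gen p)) := rfl
  rw [this, h.equiv_symm_gen, linearTerms, FreeAlgebra.lift_ι_apply]

theorem fst_terms (h : IsGradedFree wt gen deg)
    (hwt : ∀ l : List (Fin 2), (l.map wt).sum = 0 → l = []) (u : B) :
    (h.terms u).fst = augmentation K u := by
  obtain ⟨z, rfl⟩ := h.equiv.surjective u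
  have : ((TrivSqZeroExt.fstHom K K (P →₀ K)).comp h.terms).comp h.equiv.toAlgHom =
      ((augmentation K).comp B.val).comp h.equiv.toAlgHom := by
    refine FreeAlgebra.hom_ext ?_
    funext p
    have h1 : h.terms (h.equiv (ι K p)) = _ := (congrArg _ (h.equiv_ι p)).trans (h.terms_gen p)
    have h2 : augmentation K (h.equiv (ι K p) : KXY K) = 0 := by
      rw [h.equiv_ι, h.augmentation_gen hwt]
    exact (congrArg TrivSqZeroExt.fst h1).trans h2.symm
  exact DFunLike.congr_fun this z

/-- The linear term of a homogeneous element involves only generators of the same degree. -/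
theorem snd_terms_apply_of_ne (h : IsGradedFree wt gen deg) {d : M} {u : B}
    (hu : (u : KXY K) ∈ comp K wt d) {p : P} (hp : deg p ≠ d) : (h.terms u).snd p = 0 := by
  have hcomm : ∀ z, (h.equiv (compProj deg d z) : KXY K) = compProj wt d (h.equiv z : KXY K) := by
    intro z
    have : B.val.toLinearMap ∘ₗ h.equiv.toAlgHom.toLinearMap ∘ₗ compProj deg d =
        compProj wt d ∘ₗ B.val.toLinearMap ∘ₗ h.equiv.toAlgHom.toLinearMap := by
      refine linearMap_ext_mon K fun l => ?_
      change (h.equiv (compProj deg d (mon K l)) : KXY K) =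
        compProj wt d (h.equiv (mon K l) : KXY K)
      classical
      rw [compProj_mon]
      have hl := h.equiv_mon_mem_comp l
      split_ifs with hd
      · rw [hd] at hl
        rw [compProj_of_mem hl]
      · rw [compProj_of_mem_of_ne hl hd, map_zero]
        rfl
    exact LinearMap.congr_fun this z
  have hz : compProj deg d (h.equiv.symm u) = h.equiv.symm u := by
    refine h.equiv.injective (Subtype.ext ?_)
    rw [hcomm, AlgEquiv.apply_symm_apply, compProj_of_mem hu]
  have : (h.terms u).snd p = cf K [p] (h.equiv.symm u) := snd_linearTerms p _
  rw [this, ← hz, cf_compProj_of_ne (by simpa using hp)]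

/-- The linear map sending each generator of one system to its linear term with respect to the
other. -/
noncomputable def change (_ : IsGradedFree wt gen deg) (h' : IsGradedFree wt gen' deg') :
    (P →₀ K) →ₗ[K] (Q →₀ K) :=
  Finsupp.linearCombination K fun p => (h'.terms (gen p)).snd

theorem change_single (h : IsGradedFree wt gen deg) (h' : IsGradedFree wt gen' deg') (p : P) :
    h.change h' (Finsupp.single p 1) = (h'.terms (gen p)).snd := by
  simp [change]

/-- Linear terms with respect to the two systems correspond under `change`, because both sides are
derivations over the augmentation and agree on generators. -/
theorem change_snd_terms (h : IsGradedFree wt gen deg) (h' : IsGradedFree wt gen' deg')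
    (hwt : ∀ l : List (Fin 2), (l.map wt).sum = 0 → l = []) (u : B) :
    h.change h' (h.terms u).snd = (h'.terms u).snd := by
  obtain ⟨z, rfl⟩ := h.equiv.surjective u
  have : ((TrivSqZeroExt.map (h.change h')).comp h.terms).comp h.equiv.toAlgHom =
      h'.terms.comp h.equiv.toAlgHom := by
    refine FreeAlgebra.hom_ext ?_
    funext p
    change TrivSqZeroExt.map (h.change h') (h.terms (h.equiv (ι K p))) =
      h'.terms (h.equiv (ι K p))
    rw [h.equiv_ι, h.terms_gen, TrivSqZeroExt.map_inr, change_single]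
    refine TrivSqZeroExt.ext ?_ ?_
    · rw [h'.fst_terms hwt, h.augmentation_gen hwt, TrivSqZeroExt.fst_inr]
    · rw [TrivSqZeroExt.snd_inr]
  have h1 := congrArg TrivSqZeroExt.snd (DFunLike.congr_fun this z)
  rw [← TrivSqZeroExt.snd_map]
  exact h1

theorem change_comp_change (h : IsGradedFree wt gen deg) (h' : IsGradedFree wt gen' deg')
    (hwt : ∀ l : List (Fin 2), (l.map wt).sum = 0 → l = []) (c : P →₀ K) :
    h'.change h (h.change h' c) = c := by
  have : h'.change h ∘ₗ h.change h' = LinearMap.id := by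
    refine Finsupp.lhom_ext' fun p => LinearMap.ext_ring ?_
    change h'.change h (h.change h' (Finsupp.single p 1)) = Finsupp.single p 1
    rw [change_single, h'.change_snd_terms h hwt, terms_gen, TrivSqZeroExt.snd_inr]
  exact LinearMap.congr_fun this c

theorem change_mem_supported (h : IsGradedFree wt gen deg) (h' : IsGradedFree wt gen' deg')
    (d : M) {c : P →₀ K} (hc : c ∈ Finsupp.supported K K {p | deg p = d}) :
    h.change h' c ∈ Finsupp.supported K K {q | deg' q = d} := by
  have : Finsupp.supported K K {p | deg p = d} ≤
      (Finsupp.supported K K {q | deg' q = d}).comap (h.change h') := by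
    rw [Finsupp.supported_eq_span_single, Submodule.span_le]
    rintro _ ⟨p, rfl, rfl⟩
    rw [SetLike.mem_coe, Submodule.mem_comap, change_single, Finsupp.mem_supported']
    exact fun q hq => h'.snd_terms_apply_of_ne (h.mem_comp p) hq
  exact this hc

/-- Two homogeneous systems of free generators of the same algebra have equally many elements of
each degree. -/
theorem nonempty_equiv (h : IsGradedFree wt gen deg) (h' : IsGradedFree wt gen' deg')
    (hwt : ∀ l : List (Fin 2), (l.map wt).sum = 0 → l = []) (d : M) :
    Nonempty ({p // deg p = d} ≃ {q // deg' q = d}) := by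
  let f : Finsupp.supported K K {p | deg p = d} →ₗ[K] Finsupp.supported K K {q | deg' q = d} :=
    (h.change h').restrict fun _ hc => h.change_mem_supported h' d hc
  let g : Finsupp.supported K K {q | deg' q = d} →ₗ[K] Finsupp.supported K K {p | deg p = d} :=
    (h'.change h).restrict fun _ hc => h'.change_mem_supported h d hc
  let e : Finsupp.supported K K {p | deg p = d} ≃ₗ[K] Finsupp.supported K K {q | deg' q = d} :=
    LinearEquiv.ofLinearMap f g
      (LinearMap.ext fun c => Subtype.ext (h'.change_comp_change h hwt c))
      (LinearMap.ext fun c => Subtype.ext (h.change_comp_change h' hwt c))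
  let b : Module.Basis {p // deg p = d} K (Finsupp.supported K K {p | deg p = d}) :=
    .ofRepr (Finsupp.supportedEquivFinsupp {p | deg p = d})
  let b' : Module.Basis {q // deg' q = d} K (Finsupp.supported K K {p | deg p = d}) :=
    .ofRepr (e.trans (Finsupp.supportedEquivFinsupp {q | deg' q = d}))
  exact ⟨b.indexEquiv b'⟩

/-- The degrees of any homogeneous system of free generators are those of a given one. -/
theorem exists_deg_eq (h : IsGradedFree wt gen deg) (h' : IsGradedFree wt gen' deg')
    (hwt : ∀ l : List (Fin 2), (l.map wt).sum = 0 → l = []) (q : Q) : ∃ p, deg p = deg' q := by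
  obtain ⟨e⟩ := h'.nonempty_equiv h hwt (deg' q)
  exact ⟨_, (e ⟨q, rfl⟩).2⟩

/-- A homogeneous system of free generators, given as a set, has as many elements of degree `d` as
a given family of homogeneous free generators. -/
theorem nonempty_equiv_set (h : IsGradedFree wt gen deg) {S : Set B} (hS : IsFreeGenSystem K S)
    (hdeg : ∀ s ∈ S, ∃ d, (s : KXY K) ∈ comp K wt d)
    (hwt : ∀ l : List (Fin 2), (l.map wt).sum = 0 → l = []) :
    (∀ s ∈ S, ∃ p, (s : KXY K) ∈ comp K wt (deg p)) ∧
      ∀ d, Nonempty ({s // s ∈ S ∧ (s : KXY K) ∈ comp K wt d} ≃ {p // deg p = d}) := by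
  choose! dS hdS using hdeg
  have hG : IsGradedFree wt (fun s : S => (s : B)) (fun s : S => dS s) :=
    ⟨hS, fun s => hdS s s.2⟩
  refine ⟨fun s hs => ?_, fun d => ?_⟩
  · obtain ⟨p, hp⟩ := h.exists_deg_eq hG hwt ⟨s, hs⟩
    exact ⟨p, hp ▸ hdS s hs⟩
  · obtain ⟨e⟩ := hG.nonempty_equiv h hwt d
    exact ⟨(Equiv.subtypeSubtypeEquivSubtypeInter (· ∈ S)
      fun s => (s : KXY K) ∈ comp K wt d).symm.trans
        ((Equiv.subtypeEquivRight fun s => hG.mem_comp_iff s d).trans e)⟩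

end IsGradedFree

end Comparison

/-! ### Free generators of the constants and of the invariants -/

section Generators

variable (K : Type*) [Field K]

open BinaryTree

/-- The bracket `x f y - y f x`. -/
noncomputable def bracket (f : KXY K) : KXY K := x K * f * y K - y K * f * x K

/-- The `SL₂`-invariant attached to a binary tree, with leading word the Dyck word of the tree:
matched pairs of letters `x ⋯ y` of the Dyck word are turned into brackets. -/
noncomputable def treeElt : BinaryTree Unit → KXY K
  | nil => 1
  | node _ a b => bracket K (treeElt a) * treeElt b

/-- The generators of the algebra of constants: `x`, and the brackets of the invariants of binary
trees. -/
noncomputable def genElt : Option (BinaryTree Unit) → KXY K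
  | none => x K
  | some a => bracket K (treeElt K a)

theorem hasLead_treeElt (a : BinaryTree Unit) : HasLead K (treeElt K a) (treeWord a) := by
  induction a with
  | nil => exact hasLead_mon []
  | node _ a b iha ihb => simpa [treeElt, treeWord, bracket] using iha.bracket.mul ihb

theorem hasLead_genElt (p : Option (BinaryTree Unit)) : HasLead K (genElt K p) (genWord p) := by
  cases p with
  | none => simpa [genElt, genWord, x] using hasLead_mon (K := K) [0]
  | some a => exact (hasLead_treeElt K a).bracket

variable {K}

theorem bracket_mem_constants {f : KXY K} (hf : f ∈ constants K) :
    bracket K f ∈ constants K := by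
  change delta K _ = 0
  have hf' : delta K f = 0 := hf
  simp [bracket, delta_mul, hf', delta_x, delta_y]

theorem treeElt_mem_constants (a : BinaryTree Unit) : treeElt K a ∈ constants K := by
  induction a with
  | nil => exact one_mem _
  | node _ a b iha ihb => exact mul_mem (bracket_mem_constants iha) ihb

theorem genElt_mem_constants (p : Option (BinaryTree Unit)) : genElt K p ∈ constants K := by
  cases p with
  | none => exact delta_x K
  | some a => exact bracket_mem_constants (treeElt_mem_constants a)

theorem matrixAct_x (g : Matrix (Fin 2) (Fin 2) K) :
    matrixAct K g (x K) = g 0 0 • x K + g 1 0 • y K := by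
  rw [matrixAct, x, FreeAlgebra.lift_ι_apply, Fin.sum_univ_two]
  rfl

theorem matrixAct_y (g : Matrix (Fin 2) (Fin 2) K) :
    matrixAct K g (y K) = g 0 1 • x K + g 1 1 • y K := by
  rw [matrixAct, y, FreeAlgebra.lift_ι_apply, Fin.sum_univ_two]
  rfl

/-- A matrix acts on `x f y - y f x`, for an invariant `f`, by its determinant. -/
theorem bracket_mem_slInvariants {f : KXY K} (hf : f ∈ slInvariants K) :
    bracket K f ∈ slInvariants K := by
  rw [mem_slInvariants] at hf ⊢
  intro g
  have hdet := g.det_coe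
  rw [Matrix.det_fin_two] at hdet
  simp only [bracket, map_sub, map_mul, hf g, matrixAct_x, matrixAct_y, add_mul, mul_add,
    smul_mul_assoc, mul_smul_comm]
  trans ((g : Matrix (Fin 2) (Fin 2) K) 0 0 * (g : Matrix (Fin 2) (Fin 2) K) 1 1 -
    (g : Matrix (Fin 2) (Fin 2) K) 0 1 * (g : Matrix (Fin 2) (Fin 2) K) 1 0) •
      (x K * f * y K - y K * f * x K)
  · module
  · rw [hdet, one_smul]

theorem treeElt_mem_slInvariants (a : BinaryTree Unit) : treeElt K a ∈ slInvariants K := by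
  induction a with
  | nil => exact one_mem _
  | node _ a b iha ihb => exact mul_mem (bracket_mem_slInvariants iha) ihb

variable (K) in
/-- The free generators of the algebra of constants. -/
noncomputable def constGen (p : Option (BinaryTree Unit)) : constants K :=
  ⟨genElt K p, genElt_mem_constants p⟩

variable (K) in
/-- The free generators of the algebra of invariants. -/
noncomputable def invGen (a : BinaryTree Unit) : slInvariants K :=
  ⟨genElt K (some a), bracket_mem_slInvariants (treeElt_mem_slInvariants a)⟩

theorem bijective_lift_constGen [CharZero K] :
    Function.Bijective (FreeAlgebra.lift K (constGen K)) := by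
  refine bijective_lift_of_hasLead (constGen K) genWord (hasLead_genElt K)
    genWord_flatten_injective fun u hu h => ?_
  refine isLowering_delta.eq_zero_of_ballot (k := 0) (by rw [pow_one]; exact hu) fun l hl => ?_
  obtain ⟨i, rfl⟩ := exists_eq_genWord_flatten hl
  exact h i

/-- The torus acts on a word with `a` letters `x` and `b` letters `y` with weight `a - b`, so
invariants only involve words with `a = b`. -/
theorem cf_eq_zero_of_mem_slInvariants [CharZero K] {u : KXY K} (hu : u ∈ slInvariants K)
    {l : List (Fin 2)} (hl : l.count 0 ≠ l.count 1) : cf K l u = 0 := by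
  let g : Matrix.SpecialLinearGroup (Fin 2) K := ⟨!![2, 0; 0, 2⁻¹], by simp [Matrix.det_fin_two]⟩
  have hx : matrixAct K (g : Matrix (Fin 2) (Fin 2) K) (ι K 0) = (2 : K) • ι K 0 := by
    have := matrixAct_x (g : Matrix (Fin 2) (Fin 2) K)
    simpa [g, x] using this
  have hy : matrixAct K (g : Matrix (Fin 2) (Fin 2) K) (ι K 1) = (2⁻¹ : K) • ι K 1 := by
    have := matrixAct_y (g : Matrix (Fin 2) (Fin 2) K)
    simpa [g, y] using this
  have hmon : ∀ m : List (Fin 2), matrixAct K (g : Matrix (Fin 2) (Fin 2) K) (mon K m) =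
      ((2 : K) ^ m.count 0 * (2⁻¹ : K) ^ m.count 1) • mon K m := by
    intro m
    induction m with
    | nil => simp
    | cons a m ih =>
      rw [mon_cons, map_mul, ih]
      match a with
      | 0 =>
        rw [hx, smul_mul_smul_comm]
        simp [pow_succ]
        ring_nf
      | 1 =>
        rw [hy, smul_mul_smul_comm]
        simp [pow_succ]
        ring_nf
  have hcf : cf K l ∘ₗ (matrixAct K (g : Matrix (Fin 2) (Fin 2) K)).toLinearMap =
      ((2 : K) ^ l.count 0 * (2⁻¹ : K) ^ l.count 1) • cf K l := by
    refine linearMap_ext_mon K fun m => ?_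
    rw [LinearMap.comp_apply, AlgHom.toLinearMap_apply, hmon, map_smul, LinearMap.smul_apply, cf_mon]
    split_ifs with h
    · rw [h]
    · simp
  have h := LinearMap.congr_fun hcf u
  rw [LinearMap.comp_apply, AlgHom.toLinearMap_apply, (mem_slInvariants K u).1 hu g,
    LinearMap.smul_apply, smul_eq_mul] at h
  by_contra hne
  have h1 : (2 : K) ^ l.count 0 * (2⁻¹ : K) ^ l.count 1 = 1 := by
    exact (mul_right_cancel₀ hne (by rw [one_mul]; exact h)).symm
  have h2 : (2 : K) ^ l.count 0 = 2 ^ l.count 1 := by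
    rw [inv_pow] at h1
    exact eq_of_mul_inv_eq_one h1
  exact hl (Nat.pow_right_injective le_rfl (by exact_mod_cast h2))

theorem bijective_lift_invGen [CharZero K] :
    Function.Bijective (FreeAlgebra.lift K (invGen K)) := by
  have hfl : ∀ i : List (BinaryTree Unit), (i.map fun a => genWord (some a)).flatten =
      ((i.map some).map genWord).flatten := fun i => by rw [List.map_map]; rfl
  refine bijective_lift_of_hasLead (invGen K) (fun a => genWord (some a))
    (fun a => hasLead_genElt K (some a)) (fun i j hij => ?_) fun u hu h => ?_
  · dsimp only at hij
    rw [hfl, hfl] at hij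
    exact List.map_injective_iff.2 (Option.some_injective _) (genWord_flatten_injective hij)
  · let g : Matrix.SpecialLinearGroup (Fin 2) K := ⟨!![1, 1; 0, 1], by simp [Matrix.det_fin_two]⟩
    have hx : matrixAct K (g : Matrix (Fin 2) (Fin 2) K) (x K) = x K := by
      rw [matrixAct_x]; simp [g]
    have hy : matrixAct K (g : Matrix (Fin 2) (Fin 2) K) (y K) = x K + y K := by
      rw [matrixAct_y]; simp [g]
    refine (isLowering_shear hx hy).eq_zero_of_ballot (k := 0) ?_ fun l hl => ?_
    · simp [(mem_slInvariants K u).1 hu g]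
    · obtain ⟨i, rfl⟩ := exists_eq_genWord_flatten hl
      by_cases hc : (i.map genWord).flatten.count 0 = (i.map genWord).flatten.count 1
      · obtain ⟨j, rfl⟩ := exists_eq_map_some_of_count_eq hc
        rw [← hfl]
        exact h j
      · exact cf_eq_zero_of_mem_slInvariants hu hc

end Generators

/-! ### Degrees of the generators -/

section Degrees

variable {K : Type*} [Field K]

/-- The bidegrees of the letters. -/
def biwt : Fin 2 → ℕ × ℕ := ![(1, 0), (0, 1)]

theorem sum_map_biwt (l : List (Fin 2)) : (l.map biwt).sum = (l.count 0, l.count 1) := by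
  induction l with
  | nil => rfl
  | cons a l ih =>
    rw [List.map_cons, List.sum_cons, ih]
    fin_cases a <;> simp [biwt, add_comm]

theorem bihom_eq_comp (a b : ℕ) : bihom K a b = comp K biwt (a, b) := by
  rw [bihom, comp]
  congr 1
  ext w
  simp only [Set.mem_ofPred_eq, Set.mem_image, sum_map_biwt, Prod.mk.injEq, word_eq_mon]
  constructor
  · rintro ⟨l, h1, h2, rfl⟩; exact ⟨l, ⟨h1, h2⟩, rfl⟩
  · rintro ⟨l, ⟨h1, h2⟩, rfl⟩; exact ⟨l, h1, h2, rfl⟩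

theorem hom_eq_comp (n : ℕ) : hom K n = comp K (fun _ : Fin 2 => 1) n := by
  rw [hom, comp]
  congr 1
  ext w
  simp only [Set.mem_ofPred_eq, Set.mem_image, word_eq_mon, List.map_const', List.sum_replicate,
    smul_eq_mul, mul_one]
  constructor
  · rintro ⟨l, h1, rfl⟩; exact ⟨l, h1, rfl⟩
  · rintro ⟨l, h1, rfl⟩; exact ⟨l, h1, rfl⟩

theorem eq_nil_of_sum_biwt (l : List (Fin 2)) (h : (l.map biwt).sum = 0) : l = [] := by
  match l with
  | [] => rfl
  | 0 :: l => rw [sum_map_biwt] at h; simp at h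
  | 1 :: l => rw [sum_map_biwt] at h; simp at h

theorem eq_nil_of_sum_one (l : List (Fin 2)) (h : (l.map fun _ => 1).sum = 0) : l = [] := by
  simpa using h

theorem bracket_mem_comp {M : Type*} [AddCommMonoid M] (wt : Fin 2 → M) {d : M} {f : KXY K}
    (hf : f ∈ comp K wt d) : bracket K f ∈ comp K wt (wt 0 + d + wt 1) := by
  refine sub_mem (mul_mem_comp (mul_mem_comp (ι_mem_comp wt 0) hf) (ι_mem_comp wt 1)) ?_
  have := mul_mem_comp (mul_mem_comp (ι_mem_comp wt 1) hf) (ι_mem_comp wt 0)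
  rwa [show wt 1 + d + wt 0 = wt 0 + d + wt 1 by abel] at this

theorem treeElt_mem_comp {M : Type*} [AddCommMonoid M] (wt : Fin 2 → M) (a : BinaryTree Unit) :
    treeElt K a ∈ comp K wt (a.numNodes • (wt 0 + wt 1)) := by
  induction a with
  | nil => simpa [treeElt, BinaryTree.numNodes] using one_mem_comp wt
  | node _ a b iha ihb =>
    have := mul_mem_comp (bracket_mem_comp wt iha) ihb
    rwa [show wt 0 + a.numNodes • (wt 0 + wt 1) + wt 1 + b.numNodes • (wt 0 + wt 1) =
      (a.numNodes + b.numNodes + 1) • (wt 0 + wt 1) by rw [add_smul, add_smul, one_smul]; abel]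
      at this

theorem bracket_treeElt_mem_comp {M : Type*} [AddCommMonoid M] (wt : Fin 2 → M)
    (a : BinaryTree Unit) :
    bracket K (treeElt K a) ∈ comp K wt ((a.numNodes + 1) • (wt 0 + wt 1)) := by
  have := bracket_mem_comp wt (treeElt_mem_comp (K := K) wt a)
  rwa [show wt 0 + a.numNodes • (wt 0 + wt 1) + wt 1 = (a.numNodes + 1) • (wt 0 + wt 1) by
    rw [add_smul, one_smul]; abel] at this

/-- The bidegrees of the generators of the algebra of constants. -/
def constDeg : Option (BinaryTree Unit) → ℕ × ℕ
  | none => (1, 0)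
  | some a => (a.numNodes + 1, a.numNodes + 1)

theorem isGradedFree_constGen [CharZero K] : IsGradedFree biwt (constGen K) constDeg where
  bijective := bijective_lift_constGen
  mem_comp p := by
    cases p with
    | none => exact ι_mem_comp biwt 0
    | some a =>
      have := bracket_treeElt_mem_comp (K := K) biwt a
      rwa [show (a.numNodes + 1) • (biwt 0 + biwt 1) = constDeg (some a) by
        simp [biwt, constDeg]] at this

theorem isGradedFree_invGen [CharZero K] :
    IsGradedFree (fun _ => 1) (invGen K) fun a => 2 * (a.numNodes + 1) where
  bijective := bijective_lift_invGen
  mem_comp a := by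
    have := bracket_treeElt_mem_comp (K := K) (fun _ => 1) a
    rwa [smul_eq_mul, one_add_one_eq_two, mul_comm] at this

instance finite_numNodes_eq (n : ℕ) : Finite {a : BinaryTree Unit // a.numNodes = n} :=
  Finite.of_equiv (BinaryTree.treesOfNumNodesEq n)
    (Equiv.subtypeEquivRight fun _ => BinaryTree.mem_treesOfNumNodesEq)

theorem card_numNodes_eq (n : ℕ) :
    Nat.card {a : BinaryTree Unit // a.numNodes = n} = catalan n := by
  rw [← BinaryTree.treesOfNumNodesEq_card_eq_catalan, ← Nat.card_eq_finsetCard]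
  exact Nat.card_congr (Equiv.subtypeEquivRight fun _ => BinaryTree.mem_treesOfNumNodesEq.symm)

end Degrees

/-! ### The generating function -/

section GeneratingFunction

theorem sqrtOneSubFourX_eq :
    sqrtOneSubFourX =
      1 - 2 * (PowerSeries.X * PowerSeries.catalanSeries.map (Nat.castRingHom ℚ)) := by
  set C := PowerSeries.catalanSeries.map (Nat.castRingHom ℚ) with hC
  have h : C ^ 2 * PowerSeries.X + 1 = C := by
    have := congrArg (PowerSeries.map (Nat.castRingHom ℚ))
      PowerSeries.catalanSeries_sq_mul_X_add_one
    simpa using this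
  have hsq : sqrtOneSubFourX ^ 2 = (1 - 2 * (PowerSeries.X * C)) ^ 2 := by
    rw [sqrtOneSubFourX_sq]
    linear_combination (-4 * PowerSeries.X) * h
  rcases sq_eq_sq_iff_eq_or_eq_neg.1 hsq with h' | h'
  · exact h'
  · have h0 := congrArg PowerSeries.constantCoeff h'
    rw [constantCoeff_sqrtOneSubFourX] at h0
    norm_num at h0

theorem coeff_sqrtOneSubFourX_succ (n : ℕ) :
    PowerSeries.coeff (n + 1) sqrtOneSubFourX = -2 * catalan n := by
  have h2 : (2 : PowerSeries ℚ) = PowerSeries.C 2 := (map_ofNat PowerSeries.C 2).symm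
  rw [sqrtOneSubFourX_eq, map_sub, h2, PowerSeries.coeff_C_mul, PowerSeries.coeff_succ_X_mul,
    PowerSeries.coeff_map, PowerSeries.catalanSeries_coeff, PowerSeries.coeff_one]
  simp

theorem coeff_zero_sqrtOneSubFourX : PowerSeries.coeff 0 sqrtOneSubFourX = 1 := by
  rw [PowerSeries.coeff_zero_eq_constantCoeff_apply, constantCoeff_sqrtOneSubFourX]

theorem coeff_t_add_half_mul_one_sub_sqrt (m : Fin 2 →₀ ℕ) :
    MvPowerSeries.coeff m (t + MvPowerSeries.C (1 / 2 : ℚ) * (1 - sqrtOneSubFourV)) =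
      if m 1 = 0 then (if m 0 = 1 then 1 else 0)
      else (if m 0 = 0 then (catalan (m 1 - 1) : ℚ) else 0) := by
  classical
  rw [map_add, t, MvPowerSeries.coeff_X, MvPowerSeries.coeff_C_mul, map_sub,
    MvPowerSeries.coeff_one, sqrtOneSubFourV, v, PowerSeries.coeff_subst_single]
  simp only [Finsupp.ext_iff, Fin.forall_fin_two, Finsupp.single_apply]
  rcases hq : m 1 with _ | n
  · by_cases h0 : m 0 = 0 <;> simp [h0, coeff_zero_sqrtOneSubFourX]
  · by_cases h0 : m 0 = 0 <;> simp [h0, coeff_sqrtOneSubFourX_succ]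

/-- The number of generators of bidegree `(p + q, q)` in the system `constGen`. -/
theorem finite_and_card_constDeg_eq (p q : ℕ) :
    Finite {g // constDeg g = (p + q, q)} ∧
    Nat.card {g // constDeg g = (p + q, q)} =
      if q = 0 then (if p = 1 then 1 else 0) else (if p = 0 then catalan (q - 1) else 0) := by
  rcases q with _ | n
  · by_cases hp : p = 1
    · subst hp
      have : Unique {g // constDeg g = (1 + 0, 0)} :=
        { default := ⟨none, rfl⟩
          uniq := fun ⟨g, hg⟩ => by
            cases g with
            | none => rfl
            | some a => simp [constDeg] at hg }
      exact ⟨inferInstance, by simp⟩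
    · have : IsEmpty {g // constDeg g = (p + 0, 0)} := ⟨fun ⟨g, hg⟩ => by
        cases g with
        | none => simp [constDeg] at hg; omega
        | some a => simp [constDeg] at hg⟩
      exact ⟨inferInstance, by simp [hp]⟩
  · by_cases hp : p = 0
    · subst hp
      let e : {a : BinaryTree Unit // a.numNodes = n} ≃
          {g // constDeg g = (0 + (n + 1), n + 1)} :=
        { toFun := fun a => ⟨some a.1, by simp [constDeg, a.2]⟩
          invFun := fun g => match g with
            | ⟨none, hg⟩ => absurd hg (by simp [constDeg])
            | ⟨some a, hg⟩ => ⟨a, by simpa [constDeg] using hg⟩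
          left_inv := fun _ => rfl
          right_inv := fun g => match g with
            | ⟨none, hg⟩ => absurd hg (by simp [constDeg])
            | ⟨some a, hg⟩ => rfl }
      refine ⟨Finite.of_equiv _ e, ?_⟩
      rw [← Nat.card_congr e, card_numNodes_eq]
      simp
    · have : IsEmpty {g // constDeg g = (p + (n + 1), n + 1)} := ⟨fun ⟨g, hg⟩ => by
        cases g with
        | none => simp [constDeg] at hg
        | some a => simp [constDeg] at hg; omega⟩
      exact ⟨inferInstance, by simp [hp]⟩

theorem exists_constDeg_eq (g : Option (BinaryTree Unit)) :
    ∃ p q, constDeg g = (p + q, q) := by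
  cases g with
  | none => exact ⟨1, 0, rfl⟩
  | some a => exact ⟨0, a.numNodes + 1, by simp [constDeg]⟩

theorem finite_constDeg_eq (d : ℕ × ℕ) : Finite {g // constDeg g = d} := by
  by_cases h : ∃ g, constDeg g = d
  · obtain ⟨g, rfl⟩ := h
    obtain ⟨p, q, h⟩ := exists_constDeg_eq g
    rw [h]
    exact (finite_and_card_constDeg_eq p q).1
  · have : IsEmpty {g // constDeg g = d} := ⟨fun ⟨g, hg⟩ => h ⟨g, hg⟩⟩
    infer_instance

end GeneratingFunction

end FreeConstants

open FreeConstants in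
theorem mainTheorem5 (K : Type*) [Field K] [CharZero K] :
    -- the algebra of constants is free, on a bihomogeneous system of free generators
    (∃ S : Set (constants K), IsFreeGenSystem K S ∧ IsBihomogeneous K S) ∧
    -- the generating function of any such system
    (∀ S : Set (constants K), IsFreeGenSystem K S → IsBihomogeneous K S →
      (∀ s ∈ S, ∃ p q : ℕ, (s : KXY K) ∈ bihom K (p + q) q) ∧
      (∀ a b : ℕ, (ofBidegree K S a b).Finite) ∧
      genFun K S = t + MvPowerSeries.C (1 / 2 : ℚ) * (1 - sqrtOneSubFourV)) ∧
    -- the invariants of the special linear group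
    (∃ T : Set (slInvariants K), IsFreeGenSystem K T ∧ IsHomogeneous K T) ∧
    (∀ T : Set (slInvariants K), IsFreeGenSystem K T → IsHomogeneous K T →
      (∀ s ∈ T, ∃ n : ℕ, 1 ≤ n ∧ (s : KXY K) ∈ hom K (2 * n)) ∧
      (∀ n : ℕ, 1 ≤ n → (ofDegree K T (2 * n)).Finite ∧
        (ofDegree K T (2 * n)).ncard = catalan (n - 1))) := by
  have hC := isGradedFree_constGen (K := K)
  have hI := isGradedFree_invGen (K := K)
  refine ⟨⟨_, (isFreeGenSystem_range hC.bijective).1, ?_⟩, fun S hS hhom => ?_,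
    ⟨_, (isFreeGenSystem_range hI.bijective).1, ?_⟩, fun T hT hhom => ?_⟩
  · rintro _ ⟨g, rfl⟩
    exact ⟨_, _, by rw [bihom_eq_comp]; exact hC.mem_comp g⟩
  · obtain ⟨hdeg, hcard⟩ := hC.nonempty_equiv_set hS (fun s hs => by
      obtain ⟨a, b, h⟩ := hhom s hs
      exact ⟨(a, b), by rwa [← bihom_eq_comp]⟩) eq_nil_of_sum_biwt
    have hcard' : ∀ a b, Nonempty (ofBidegree K S a b ≃ {g // constDeg g = (a, b)}) := by
      intro a b
      obtain ⟨e⟩ := hcard (a, b)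
      refine ⟨(Equiv.subtypeEquivRight fun s => ?_).trans e⟩
      rw [← bihom_eq_comp]
      rfl
    refine ⟨fun s hs => ?_, fun a b => ?_, ?_⟩
    · obtain ⟨g, hg⟩ := hdeg s hs
      obtain ⟨p, q, h⟩ := exists_constDeg_eq g
      exact ⟨p, q, by rwa [bihom_eq_comp, ← h]⟩
    · obtain ⟨e⟩ := hcard' a b
      have := finite_constDeg_eq (a, b)
      exact Finite.of_equiv _ e.symm
    · refine MvPowerSeries.ext fun m => ?_
      obtain ⟨e⟩ := hcard' (m 0 + m 1) (m 1)
      have h1 : MvPowerSeries.coeff m (genFun K S) =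
          ((ofBidegree K S (m 0 + m 1) (m 1)).ncard : ℚ) := rfl
      rw [h1, coeff_t_add_half_mul_one_sub_sqrt, ← Nat.card_coe_set_eq, Nat.card_congr e,
        (finite_and_card_constDeg_eq _ _).2]
      split_ifs <;> simp
  · rintro _ ⟨a, rfl⟩
    exact ⟨_, by rw [hom_eq_comp]; exact hI.mem_comp a⟩
  · obtain ⟨hdeg, hcard⟩ := hI.nonempty_equiv_set hT (fun s hs => by
      obtain ⟨n, h⟩ := hhom s hs
      exact ⟨n, by rwa [← hom_eq_comp]⟩) eq_nil_of_sum_one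
    refine ⟨fun s hs => ?_, fun n hn => ?_⟩
    · obtain ⟨a, ha⟩ := hdeg s hs
      exact ⟨a.numNodes + 1, Nat.le_add_left _ _, by rwa [hom_eq_comp]⟩
    · obtain ⟨n, rfl⟩ := Nat.exists_eq_add_of_le' hn
      obtain ⟨e⟩ := hcard (2 * (n + 1))
      have e' : ofDegree K T (2 * (n + 1)) ≃ {a : BinaryTree Unit // a.numNodes = n} := by
        refine ((Equiv.subtypeEquivRight fun s => ?_).trans e).trans
          (Equiv.subtypeEquivRight fun a => by omega)
        rw [← hom_eq_comp]
        rfl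
      refine ⟨Finite.of_equiv _ e'.symm, ?_⟩
      rw [← Nat.card_coe_set_eq, Nat.card_congr e', card_numNodes_eq, Nat.add_sub_cancel]
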